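/- Let $K$ be a field of characteristic zero, let $n\ge 2$ and $d\ge 2$ be integers, and let $P=P\langle x_1,\dots,x_n\rangle$ be the free Poisson algebra over $K$, that is, the symmetric algebra of the free Lie algebra $\mathrm{Lie}\langle x_1,\dots,x_n\rangle$ with the unique Poisson bracket extending the Lie bracket. Grade $P$ by degree with $\deg x_i=1$, where the degree is additive under both the product and the bracket. For $i\in\mathbb{Z}/d\mathbb{Z}$ let $P_i$ be the span of all homogeneous elements of $P$ whose degree is congruent to $i$ modulo $d$; in particular $P_0$ is a Poisson subalgebra of $P$ (the Veronese subalgebra of degree $d$). A Poisson derivation of a Poisson algebra is a $K$-linear map $D$ with $D(ab)=D(a)b+aD(b)$ and $D(\{a,b\})=\{D(a),b\}+\{a,D(b)\}$ for all $a,b$; a Poisson derivation $D$ of $P$ is called $d$-graded if $D(x_1),\dots,D(x_n)\in P_1$. Then for every Poisson derivation $D$ of $P_0$ there is exactly one $d$-graded Poisson derivation of $P$ whose restriction to $P_0$ is $D$. -/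

import Mathlib

/-- A Poisson algebra over `K`: a commutative associative `K`-algebra `P` with a bilinear bracket
which is a Lie bracket (alternating, with the Jacobi identity) and satisfies the Leibniz identity
`{x, y z} = y {x, z} + {x, y} z`. -/
class PoissonAlgebra (K P : Type*) [CommRing K] [CommRing P] [Algebra K P] where
  bracket : P →ₗ[K] P →ₗ[K] P
  bracket_self : ∀ x, bracket x x = 0
  jacobi : ∀ x y z,
    bracket x (bracket y z) + bracket y (bracket z x) + bracket z (bracket x y) = 0
  leibniz : ∀ x y z, bracket x (y * z) = y * bracket x z + bracket x y * z

/-- The Poisson bracket `{x, y}` of a Poisson algebra over `K`. -/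
abbrev poissonBracket (K : Type*) {P : Type*} [CommRing K] [CommRing P] [Algebra K P]
    [PoissonAlgebra K P] (x y : P) : P :=
  PoissonAlgebra.bracket (K := K) x y

section

variable {K P : Type*} [CommRing K] [CommRing P] [Algebra K P] [PoissonAlgebra K P]

theorem poissonBracket_zero_left (y : P) : poissonBracket K 0 y = 0 := by
  rw [poissonBracket, map_zero, LinearMap.zero_apply]

theorem poissonBracket_add_left (x x' y : P) :
    poissonBracket K (x + x') y = poissonBracket K x y + poissonBracket K x' y := by
  rw [poissonBracket, map_add, LinearMap.add_apply]

theorem poissonBracket_smul_left (c : K) (x y : P) :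
    poissonBracket K (c • x) y = c • poissonBracket K x y := by
  rw [poissonBracket, map_smul, LinearMap.smul_apply]

end

/-- A derivation of the Poisson algebra `P`: a `K`-linear map `D : P → P` with
`D (x y) = D x y + x D y` and `D {x, y} = {D x, y} + {x, D y}`. -/
@[ext]
structure PoissonDerivation (K P : Type*) [CommRing K] [CommRing P] [Algebra K P]
    [PoissonAlgebra K P] extends Derivation K P P where
  map_bracket : ∀ x y : P, toDerivation (poissonBracket K x y) =
    poissonBracket K (toDerivation x) y + poissonBracket K x (toDerivation y)

/-! ### The Poisson enveloping algebra of a Lie algebra -/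

namespace PoissonEnveloping

variable (K L : Type*) [CommRing K] [LieRing L] [LieAlgebra K L]

/-- The algebra homomorphism `Sym L → (Sym L)[ε]`, `x ↦ x + f x ε` for `x` in `L`. -/
noncomputable def toDual (f : L →ₗ[K] SymmetricAlgebra K L) :
    SymmetricAlgebra K L →ₐ[K] TrivSqZeroExt (SymmetricAlgebra K L) (SymmetricAlgebra K L) :=
  SymmetricAlgebra.lift
    { toFun := fun x => (TrivSqZeroExt.inl (SymmetricAlgebra.ι K L x) + TrivSqZeroExt.inr (f x))
      map_add' := fun x y => by
        ext <;> simp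
      map_smul' := fun c x => by
        ext <;> simp }

theorem toDual_fst (f : L →ₗ[K] SymmetricAlgebra K L) (a : SymmetricAlgebra K L) :
    (toDual K L f a).fst = a := by
  have h : (TrivSqZeroExt.fstHom K (SymmetricAlgebra K L) (SymmetricAlgebra K L)).comp
      (toDual K L f) = AlgHom.id K _ := by
    apply SymmetricAlgebra.algHom_ext
    ext x
    simp [toDual]
  exact congrArg (fun g => g a) h

/-- The unique derivation of `Sym L` whose restriction to `L` is the linear map `f`. -/
noncomputable def liftDer (f : L →ₗ[K] SymmetricAlgebra K L) :
    Derivation K (SymmetricAlgebra K L) (SymmetricAlgebra K L) :=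
  Derivation.mk'
    { toFun := fun a => (toDual K L f a).snd
      map_add' := fun a b => by simp
      map_smul' := fun c a => by simp }
    (fun a b => by
      simp [TrivSqZeroExt.snd_mul, toDual_fst, mul_comm])

@[simp]
theorem liftDer_ι (f : L →ₗ[K] SymmetricAlgebra K L) (x : L) :
    liftDer K L f (SymmetricAlgebra.ι K L x) = f x := by
  change (toDual K L f _).snd = _
  simp [toDual]

variable {K L} in
/-- Derivations of `Sym L` are determined by their values on `L`. -/
theorem der_ext {D E : Derivation K (SymmetricAlgebra K L) (SymmetricAlgebra K L)}
    (h : ∀ x, D (SymmetricAlgebra.ι K L x) = E (SymmetricAlgebra.ι K L x)) : D = E := by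
  ext a
  induction a using SymmetricAlgebra.induction with
  | algebraMap r => simp
  | ι x => exact h x
  | mul a b ha hb => simp [ha, hb]
  | add a b ha hb => simp [ha, hb]

/-- `ad x`, the derivation of `Sym L` that extends `[x, -]`. -/
noncomputable def ad (x : L) : Derivation K (SymmetricAlgebra K L) (SymmetricAlgebra K L) :=
  liftDer K L (SymmetricAlgebra.ι K L ∘ₗ (LieAlgebra.ad K L x : L →ₗ[K] L))

/-- The derivation `{a, -}` of `Sym L`, determined by `{a, x} = - (ad x) a` for `x` in `L`. -/
noncomputable def ham (a : SymmetricAlgebra K L) :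
    Derivation K (SymmetricAlgebra K L) (SymmetricAlgebra K L) :=
  liftDer K L
    { toFun := fun x => -(ad K L x a)
      map_add' := fun x y => by
        have h : ad K L (x + y) = ad K L x + ad K L y := der_ext fun z => by simp [ad]
        rw [h, Derivation.add_apply, neg_add]
      map_smul' := fun c x => by
        have h : ad K L (c • x) = c • ad K L x := der_ext fun z => by simp [ad]
        rw [h, Derivation.smul_apply, RingHom.id_apply, smul_neg] }

theorem ham_ι_ι (x y : L) : ham K L (SymmetricAlgebra.ι K L x) (SymmetricAlgebra.ι K L y) =
    SymmetricAlgebra.ι K L ⁅x, y⁆ := by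
  simp [ham, ad, ← map_neg]

theorem ham_add (a b : SymmetricAlgebra K L) : ham K L (a + b) = ham K L a + ham K L b :=
  der_ext fun z => by simp [ham, add_comm]

theorem ham_smul (c : K) (a : SymmetricAlgebra K L) : ham K L (c • a) = c • ham K L a :=
  der_ext fun z => by simp [ham]

theorem ham_mul (a b : SymmetricAlgebra K L) :
    ham K L (a * b) = a • ham K L b + b • ham K L a :=
  der_ext fun z => by simp [ham, add_comm]

theorem ham_algebraMap (c : K) : ham K L (algebraMap K _ c) = 0 :=
  der_ext fun z => by simp [ham]

theorem ham_zero : ham K L 0 = 0 :=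
  der_ext fun z => by simp [ham]

theorem ham_neg (a : SymmetricAlgebra K L) : ham K L (-a) = -ham K L a :=
  der_ext fun z => by simp [ham]

theorem ham_antisymm (a b : SymmetricAlgebra K L) : ham K L a b = -ham K L b a := by
  induction a using SymmetricAlgebra.induction with
  | algebraMap r => simp [ham_algebraMap]
  | mul a c ha hc => simp [ham_mul, ha, hc]; ring
  | add a c ha hc => simp [ham_add, ha, hc]; ring
  | ι x =>
    induction b using SymmetricAlgebra.induction with
    | algebraMap r => simp [ham_algebraMap]
    | mul a c ha hc => simp [ham_mul, ha, hc]; ring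
    | add a c ha hc => simp [ham_add, ha, hc]; ring
    | ι y => rw [ham_ι_ι, ham_ι_ι, ← lie_skew, map_neg]

theorem ham_self (a : SymmetricAlgebra K L) : ham K L a a = 0 := by
  induction a using SymmetricAlgebra.induction with
  | algebraMap r => simp [ham_algebraMap]
  | mul a c ha hc =>
    have := ham_antisymm K L a c
    simp [ham_mul, ha, hc, this]; ring
  | add a c ha hc =>
    have := ham_antisymm K L a c
    simp [ham_add, ha, hc, this]
  | ι x => rw [ham_ι_ι, lie_self, map_zero]

theorem ham_jacobi (a b c : SymmetricAlgebra K L) :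
    ham K L a (ham K L b c) = ham K L (ham K L a b) c + ham K L b (ham K L a c) := by
  induction a using SymmetricAlgebra.induction with
  | algebraMap r => simp [ham_algebraMap, ham_zero]
  | mul a a' h h' =>
    simp [ham_mul, ham_add, ham_neg, h, h', ham_antisymm K L a b, ham_antisymm K L a' b]; ring
  | add a a' h h' => simp [ham_add, h, h']; ring
  | ι x =>
    induction b using SymmetricAlgebra.induction with
    | algebraMap r => simp [ham_algebraMap, ham_zero]
    | mul b b' h h' =>
      simp [ham_mul, ham_add, h, h']; ring
    | add b b' h h' => simp [ham_add, h, h']; ring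
    | ι y =>
      induction c using SymmetricAlgebra.induction with
      | algebraMap r => simp
      | mul c c' h h' => simp [h, h']; ring
      | add c c' h h' => simp [h, h']; ring
      | ι z => rw [ham_ι_ι, ham_ι_ι, ham_ι_ι, ham_ι_ι, ham_ι_ι, ham_ι_ι, leibniz_lie, map_add]

/-- The Poisson enveloping algebra of `L`: the symmetric algebra `Sym L` (that is, the polynomial
algebra on a basis of `L`) with the unique Poisson bracket that extends the Lie bracket of `L`. -/
noncomputable instance : PoissonAlgebra K (SymmetricAlgebra K L) where
  bracket :=
    { toFun := fun a => (ham K L a).toLinearMap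
      map_add' := fun a b => by rw [ham_add]; rfl
      map_smul' := fun c a => by rw [ham_smul]; rfl }
  bracket_self := ham_self K L
  jacobi := fun a b c => by
    change ham K L a (ham K L b c) + ham K L b (ham K L c a) + ham K L c (ham K L a b) = 0
    rw [ham_jacobi, ham_antisymm K L c a, ham_antisymm K L c (ham K L a b), map_neg]
    ring
  leibniz := fun a b c => by
    change ham K L a (b * c) = b * ham K L a c + ham K L a b * c
    rw [Derivation.leibniz, smul_eq_mul, smul_eq_mul, mul_comm c]

theorem bracket_ι_ι (x y : L) :
    poissonBracket K (SymmetricAlgebra.ι K L x) (SymmetricAlgebra.ι K L y) =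
      SymmetricAlgebra.ι K L ⁅x, y⁆ :=
  ham_ι_ι K L x y

end PoissonEnveloping

/-! ### Free Poisson algebras, their grading by degree, and Veronese subalgebras -/

/-- The free Poisson algebra `P⟨x₁, …, xₙ⟩`: the Poisson enveloping algebra of the free Lie algebra
in `x₁, …, xₙ`. -/
abbrev FreePoisson (K : Type*) [CommRing K] (n : ℕ) : Type _ :=
  SymmetricAlgebra K (FreeLieAlgebra K (Fin n))

namespace FreePoisson

variable (K : Type*) [CommRing K] {n : ℕ}

/-- The free generators `x₁, …, xₙ`. -/
noncomputable def x (i : Fin n) : FreePoisson K n :=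
  SymmetricAlgebra.ι K _ (FreeLieAlgebra.of K i)

/-- `IsLieWord K u m`: `u` is an iterated Lie bracket (with any arrangement of parentheses) of `m`
generators of the free Lie algebra. -/
inductive IsLieWord : FreeLieAlgebra K (Fin n) → ℕ → Prop
  | of (i : Fin n) : IsLieWord (FreeLieAlgebra.of K i) 1
  | lie {u v : FreeLieAlgebra K (Fin n)} {k m : ℕ} :
      IsLieWord u k → IsLieWord v m → IsLieWord ⁅u, v⁆ (k + m)

/-- `IsMonomial K f m`: `f` is a (possibly empty) product of iterated Lie brackets of generators
whose degrees add up to `m`. -/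
inductive IsMonomial : FreePoisson K n → ℕ → Prop
  | one : IsMonomial 1 0
  | lie_mul {u : FreeLieAlgebra K (Fin n)} {f : FreePoisson K n} {k m : ℕ} :
      IsLieWord K u k → IsMonomial f m → IsMonomial (SymmetricAlgebra.ι K _ u * f) (k + m)

variable (n) in
/-- The subspace of all homogeneous elements of degree `m`, where each generator has degree `1`. -/
noncomputable def homogeneous (m : ℕ) : Submodule K (FreePoisson K n) :=
  Submodule.span K {f | IsMonomial K f m}

variable (n) in
/-- The component `P_i` of the `d`-grading of `P`: the span of all homogeneous elements whose
degree is congruent to `i` modulo `d`. -/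
noncomputable def gradedPart (d : ℕ) (i : ZMod d) : Submodule K (FreePoisson K n) :=
  Submodule.span K {f | ∃ m : ℕ, (m : ZMod d) = i ∧ f ∈ homogeneous K n m}

variable {K}

theorem IsMonomial.mul {f g : FreePoisson K n} {k m : ℕ} (hf : IsMonomial K f k)
    (hg : IsMonomial K g m) : IsMonomial K (f * g) (k + m) := by
  induction hf with
  | one => simpa using hg
  | lie_mul hu _ ih => rw [mul_assoc, add_assoc]; exact .lie_mul hu ih

theorem mul_mem_homogeneous {f g : FreePoisson K n} {k m : ℕ} (hf : f ∈ homogeneous K n k)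
    (hg : g ∈ homogeneous K n m) : f * g ∈ homogeneous K n (k + m) := by
  induction hf using Submodule.span_induction with
  | zero => simp
  | add f f' _ _ h h' => rw [add_mul]; exact add_mem h h'
  | smul c f _ h => rw [smul_mul_assoc]; exact Submodule.smul_mem _ c h
  | mem f hf =>
    induction hg using Submodule.span_induction with
    | zero => simp
    | add g g' _ _ h h' => rw [mul_add]; exact add_mem h h'
    | smul c g _ h => rw [mul_smul_comm]; exact Submodule.smul_mem _ c h
    | mem g hg => exact Submodule.subset_span (hf.mul hg)

theorem IsLieWord.ι_mem {u : FreeLieAlgebra K (Fin n)} {k : ℕ} (hu : IsLieWord K u k) :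
    SymmetricAlgebra.ι K _ u ∈ homogeneous K n k := by
  have := IsMonomial.lie_mul hu IsMonomial.one
  rw [mul_one, add_zero] at this
  exact Submodule.subset_span this

theorem IsMonomial.bracket_mem {f g : FreePoisson K n} {k m : ℕ} (hf : IsMonomial K f k)
    (hg : IsMonomial K g m) : poissonBracket K f g ∈ homogeneous K n (k + m) := by
  change PoissonEnveloping.ham K _ f g ∈ _
  induction hf with
  | one =>
    rw [← map_one (algebraMap K (FreePoisson K n)), PoissonEnveloping.ham_algebraMap]
    simp
  | @lie_mul u f k k' hu hf ih =>
    rw [PoissonEnveloping.ham_mul, Derivation.add_apply, Derivation.smul_apply,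
      Derivation.smul_apply, smul_eq_mul, smul_eq_mul]
    refine add_mem ?_ ?_
    · rw [add_assoc]; exact mul_mem_homogeneous hu.ι_mem ih
    · have e : k + k' + m = k' + (k + m) := by ring
      rw [e]
      refine mul_mem_homogeneous (Submodule.subset_span hf) ?_
      clear ih e
      induction hg with
      | one => simp
      | @lie_mul v g l l' hv hg ih =>
        rw [Derivation.leibniz, smul_eq_mul, smul_eq_mul, PoissonEnveloping.ham_ι_ι]
        refine add_mem ?_ ?_
        · have e : k + (l + l') = l + (k + l') := by ring
          rw [e]; exact mul_mem_homogeneous hv.ι_mem ih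
        · have e : k + (l + l') = l' + (k + l) := by ring
          rw [e]
          exact mul_mem_homogeneous (Submodule.subset_span hg) (hu.lie hv).ι_mem

theorem bracket_mem_homogeneous {f g : FreePoisson K n} {k m : ℕ} (hf : f ∈ homogeneous K n k)
    (hg : g ∈ homogeneous K n m) : poissonBracket K f g ∈ homogeneous K n (k + m) := by
  induction hf using Submodule.span_induction with
  | zero => rw [poissonBracket_zero_left]; exact zero_mem _
  | add f f' _ _ h h' => rw [poissonBracket_add_left]; exact add_mem h h'
  | smul c f _ h => rw [poissonBracket_smul_left]; exact Submodule.smul_mem _ c h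
  | mem f hf =>
    induction hg using Submodule.span_induction with
    | zero => simp
    | add g g' _ _ h h' => simpa using add_mem h h'
    | smul c g _ h => simpa using Submodule.smul_mem _ c h
    | mem g hg => exact hf.bracket_mem hg

theorem mul_mem_gradedPart {d : ℕ} {i j : ZMod d} {f g : FreePoisson K n}
    (hf : f ∈ gradedPart K n d i) (hg : g ∈ gradedPart K n d j) :
    f * g ∈ gradedPart K n d (i + j) := by
  induction hf using Submodule.span_induction with
  | zero => simp
  | add f f' _ _ h h' => rw [add_mul]; exact add_mem h h'
  | smul c f _ h => rw [smul_mul_assoc]; exact Submodule.smul_mem _ c h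
  | mem f hf =>
    induction hg using Submodule.span_induction with
    | zero => simp
    | add g g' _ _ h h' => rw [mul_add]; exact add_mem h h'
    | smul c g _ h => rw [mul_smul_comm]; exact Submodule.smul_mem _ c h
    | mem g hg =>
      obtain ⟨k, rfl, hf⟩ := hf
      obtain ⟨m, rfl, hg⟩ := hg
      exact Submodule.subset_span ⟨k + m, by push_cast; rfl, mul_mem_homogeneous hf hg⟩

theorem bracket_mem_gradedPart {d : ℕ} {i j : ZMod d} {f g : FreePoisson K n}
    (hf : f ∈ gradedPart K n d i) (hg : g ∈ gradedPart K n d j) :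
    poissonBracket K f g ∈ gradedPart K n d (i + j) := by
  induction hf using Submodule.span_induction with
  | zero => rw [poissonBracket_zero_left]; exact zero_mem _
  | add f f' _ _ h h' => rw [poissonBracket_add_left]; exact add_mem h h'
  | smul c f _ h => rw [poissonBracket_smul_left]; exact Submodule.smul_mem _ c h
  | mem f hf =>
    induction hg using Submodule.span_induction with
    | zero => simp
    | add g g' _ _ h h' => simpa using add_mem h h'
    | smul c g _ h => simpa using Submodule.smul_mem _ c h
    | mem g hg =>
      obtain ⟨k, rfl, hf⟩ := hf
      obtain ⟨m, rfl, hg⟩ := hg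
      exact Submodule.subset_span ⟨k + m, by push_cast; rfl, bracket_mem_homogeneous hf hg⟩

theorem algebraMap_mem_gradedPart (d : ℕ) (c : K) :
    algebraMap K (FreePoisson K n) c ∈ gradedPart K n d 0 := by
  rw [Algebra.algebraMap_eq_smul_one]
  exact Submodule.smul_mem _ c
    (Submodule.subset_span ⟨0, by simp, Submodule.subset_span IsMonomial.one⟩)

variable (K n) in
/-- The Veronese subalgebra `P_0` of degree `d` of the free Poisson algebra `P`. -/
noncomputable def veronese (d : ℕ) : Subalgebra K (FreePoisson K n) where
  carrier := gradedPart K n d 0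
  add_mem' := add_mem
  mul_mem' := fun hf hg => by simpa using mul_mem_gradedPart hf hg
  algebraMap_mem' := algebraMap_mem_gradedPart d

theorem bracket_mem_veronese {d : ℕ} {f g : FreePoisson K n}
    (hf : f ∈ veronese K n d) (hg : g ∈ veronese K n d) :
    poissonBracket K f g ∈ veronese K n d := by
  have h := bracket_mem_gradedPart (d := d) hf hg
  rwa [add_zero] at h

/-- `P_0` is a Poisson algebra with the bracket of `P`. -/
noncomputable instance (d : ℕ) : PoissonAlgebra K (veronese K n d) where
  bracket := LinearMap.mk₂ K
    (fun f g => ⟨poissonBracket K (f : FreePoisson K n) g, bracket_mem_veronese f.2 g.2⟩)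
    (fun f f' g => Subtype.ext (poissonBracket_add_left _ _ _))
    (fun c f g => Subtype.ext (poissonBracket_smul_left _ _ _))
    (fun f g g' => Subtype.ext (by simp))
    (fun c f g => Subtype.ext (by simp))
  bracket_self := fun f => Subtype.ext (PoissonAlgebra.bracket_self (K := K) (f : FreePoisson K n))
  jacobi := fun f g h => Subtype.ext (PoissonAlgebra.jacobi (K := K) (f : FreePoisson K n) g h)
  leibniz := fun f g h => Subtype.ext (PoissonAlgebra.leibniz (K := K) (f : FreePoisson K n) g h)

/-- A Poisson derivation `D` of `P` is `d`-graded if `D x₁, …, D xₙ` lie in `P_1`. -/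
def IsGradedDerivation (d : ℕ) (D : PoissonDerivation K (FreePoisson K n)) : Prop :=
  ∀ i : Fin n, D.toDerivation (x K i) ∈ gradedPart K n d 1

end FreePoisson

/-! Write `P` for the free Poisson algebra; it is a polynomial ring over a field, hence a domain of
characteristic zero, and the generators are pairwise non-associate primes in it.

A derivation `E` of `P` extending `D` must satisfy `D (xᵢ ^ d) = d xᵢ ^ (d - 1) E xᵢ`, which
determines `E xᵢ` and hence `E`. Conversely, for `j ≠ i` apply `D` to `(xⱼ ^ (d - 1) xᵢ) ^ d = xᵢ ^
d (xⱼ ^ d) ^ (d - 1)`, an identity inside `P_0`: since `xᵢ` is a prime not dividing `xⱼ`, `xᵢ ^ (d -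
1)` divides `D (xᵢ ^ d)` (`x_pow_dvd_derivation`). So candidates `aᵢ` for `E xᵢ` exist, and freeness
of `P` gives a Poisson derivation `E` with these values (`derivationOf`). As `d xᵢ ^ (d - 1) aᵢ`
lies in `P_0`, comparing degrees puts `aᵢ` in `P_1`.

It remains to see that `E` and `D` agree on all of `P_0`, knowing this for the `xᵢ ^ d`. The set
where they agree is closed under sums, products and brackets, and, within `P_0`, under extracting
roots and dividing by nonzero members. Fix one generator `xᵢ`. Induction on Lie words shows that
each word, multiplied by a high power of `xᵢ`, lies in this set
(`Agree.exists_x_pow_mul_isLieWord`); hence so does each monomial, and for monomials in `P_0` the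
power of `xᵢ` can be divided out (`Agree.of_isMonomial`). -/

section

attribute [local instance 100] LieRing.ofAssociativeRing

/-! ### Generation of the free Lie algebra. -/

namespace FreeLieAlgebra

variable {R X : Type*} [CommRing R]

/-- By freeness the generators lift to a homomorphism into their own span; followed by the inclusion
it fixes the generators, so it is the identity. -/
theorem lieSpan_range_of : LieSubalgebra.lieSpan R (FreeLieAlgebra R X) (Set.range (of R)) = ⊤ := by
  set S := LieSubalgebra.lieSpan R (FreeLieAlgebra R X) (Set.range (of R)) with hS
  let φ : FreeLieAlgebra R X →ₗ⁅R⁆ S :=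
    lift R fun i => ⟨of R i, LieSubalgebra.subset_lieSpan ⟨i, rfl⟩⟩
  have h : S.incl.comp φ = LieHom.id := hom_ext fun i => by simp [φ]
  rw [eq_top_iff]
  intro u _
  have hu : S.incl (φ u) = u := congrArg (fun g => g u) h
  rw [← hu]
  exact (φ u).2

@[elab_as_elim]
theorem induction {p : FreeLieAlgebra R X → Prop} (u : FreeLieAlgebra R X)
    (of : ∀ i, p (of R i)) (zero : p 0) (add : ∀ u v, p u → p v → p (u + v))
    (smul : ∀ (c : R) u, p u → p (c • u)) (lie : ∀ u v, p u → p v → p ⁅u, v⁆) : p u := by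
  let S : LieSubalgebra R (FreeLieAlgebra R X) :=
    { carrier := {u | p u}
      add_mem' := fun {u v} hu hv => add u v hu hv
      zero_mem' := zero
      smul_mem' := fun c u hu => smul c u hu
      lie_mem' := fun {u v} hu hv => lie u v hu hv }
  have h : LieSubalgebra.lieSpan R (FreeLieAlgebra R X) (Set.range (FreeLieAlgebra.of R)) ≤ S := by
    rw [LieSubalgebra.lieSpan_le]
    rintro _ ⟨i, rfl⟩
    exact of i
  exact h (lieSpan_range_of (R := R) ▸ LieSubalgebra.mem_top u)

end FreeLieAlgebra

/-! ### Poisson derivations of the free Poisson algebra with prescribed values. -/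

namespace PoissonEnveloping

variable {K L : Type*} [CommRing K] [LieRing L] [LieAlgebra K L]

theorem poissonBracket_eq_ham (a b : SymmetricAlgebra K L) :
    poissonBracket K a b = ham K L a b := rfl

theorem ham_ι (u : L) : ham K L (SymmetricAlgebra.ι K L u) = ad K L u :=
  der_ext fun v => by rw [ham_ι_ι, ad, liftDer_ι]; simp

variable (K L) in
/-- The action of `L` on `Sym L` by `ad`, where `Sym L` is regarded as an abelian Lie algebra. -/
noncomputable def adLie : L →ₗ⁅K⁆ LieDerivation K (SymmetricAlgebra K L) (SymmetricAlgebra K L) where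
  toFun u :=
    { (ad K L u).toLinearMap with
      -- The Lie bracket on `Sym L` meant here is the commutator, which vanishes.
      leibniz' := fun a b => by simp [Ring.lie_def, mul_comm] }
  map_add' u v := by
    ext a
    change ad K L (u + v) a = ad K L u a + ad K L v a
    rw [← ham_ι, ← ham_ι, ← ham_ι, map_add, ham_add, Derivation.add_apply]
  map_smul' c u := by
    ext a
    change ad K L (c • u) a = c • ad K L u a
    rw [← ham_ι, ← ham_ι, map_smul, ham_smul, Derivation.smul_apply]
  map_lie' {u v} := by
    ext a
    rw [LieDerivation.lie_apply]
    change ad K L ⁅u, v⁆ a = ad K L u (ad K L v a) - ad K L v (ad K L u a)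
    rw [← ham_ι, ← ham_ι, ← ham_ι, ham_jacobi, ham_ι_ι, add_sub_cancel_right]

theorem adLie_apply (u : L) (a : SymmetricAlgebra K L) :
    adLie K L u a = ham K L (SymmetricAlgebra.ι K L u) a := by
  rw [ham_ι]; rfl

/-- A derivation of `Sym L` that satisfies the bracket identity on `L` is a Poisson derivation. -/
theorem der_map_bracket (E : Derivation K (SymmetricAlgebra K L) (SymmetricAlgebra K L))
    (h : ∀ u v : L, E (SymmetricAlgebra.ι K L ⁅u, v⁆) =
      ham K L (E (SymmetricAlgebra.ι K L u)) (SymmetricAlgebra.ι K L v) +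
      ham K L (SymmetricAlgebra.ι K L u) (E (SymmetricAlgebra.ι K L v)))
    (a b : SymmetricAlgebra K L) :
    E (ham K L a b) = ham K L (E a) b + ham K L a (E b) := by
  induction a using SymmetricAlgebra.induction with
  | algebraMap r => simp [ham_algebraMap, ham_zero]
  | mul a a' h h' => simp [ham_mul, ham_add, h, h']; ring
  | add a a' h h' => simp [ham_add, h, h']; ring
  | ι u =>
    induction b using SymmetricAlgebra.induction with
    | algebraMap r => simp
    | mul b b' h h' => simp [h, h']; ring
    | add b b' h h' => simp [h, h']; ring
    | ι v => rw [ham_ι_ι, h]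

end PoissonEnveloping

namespace FreePoisson

open PoissonEnveloping

variable {K : Type*} [CommRing K] {n : ℕ}

/-- The Lie algebra homomorphism `u ↦ (δ u, u)` whose first component is the `1`-cocycle `δ` of the
free Lie algebra with values in `P` such that `δ xᵢ = aᵢ`. -/
noncomputable def cocycleHom (a : Fin n → FreePoisson K n) :
    FreeLieAlgebra K (Fin n) →ₗ⁅K⁆
      LieAlgebra.SemiDirectSum (FreePoisson K n) (FreeLieAlgebra K (Fin n)) (adLie K _) :=
  FreeLieAlgebra.lift K fun i => ⟨a i, FreeLieAlgebra.of K i⟩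

/-- The second component is a Lie endomorphism fixing the generators. Hence the semidirect bracket
acts on first components through `u` and `v` themselves, which is the cocycle identity. -/
theorem cocycleHom_right (a : Fin n → FreePoisson K n) (u : FreeLieAlgebra K (Fin n)) :
    (cocycleHom a u).right = u := by
  have h : (LieAlgebra.SemiDirectSum.projr (adLie K _)).comp (cocycleHom a) = LieHom.id :=
    FreeLieAlgebra.hom_ext fun i => by simp [cocycleHom]
  exact congrArg (fun g => g u) h

/-- The derivation of the free Poisson algebra with prescribed values on the generators. -/
noncomputable def derivationOf (a : Fin n → FreePoisson K n) :
    PoissonDerivation K (FreePoisson K n) where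
  toDerivation := liftDer K _
    (LieAlgebra.SemiDirectSum.projl (adLie K _) ∘ₗ (cocycleHom a : _ →ₗ[K] _))
  map_bracket := der_map_bracket _ fun u v => by
    simp only [liftDer_ι, LinearMap.comp_apply, LieHom.coe_toLinearMap, LieHom.map_lie]
    rw [LieAlgebra.SemiDirectSum.lie_eq_mk]
    simp only [LieAlgebra.SemiDirectSum.projl_mk, cocycleHom_right, adLie_apply]
    rw [ham_antisymm K _ (cocycleHom a u).left]
    -- The commutator of the two first components vanishes, leaving only the action terms.
    simp only [Ring.lie_def, mul_comm (cocycleHom a u).left]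
    ring

theorem derivationOf_x (a : Fin n → FreePoisson K n) (i : Fin n) :
    (derivationOf a).toDerivation (x K i) = a i := by
  simp [derivationOf, x, cocycleHom]

/-- Poisson derivations of the free Poisson algebra are determined by their values on the
generators. -/
theorem poissonDerivation_ext {E F : PoissonDerivation K (FreePoisson K n)}
    (h : ∀ i, E.toDerivation (x K i) = F.toDerivation (x K i)) : E = F := by
  suffices H : E.toDerivation = F.toDerivation by
    exact PoissonDerivation.ext (congrArg (fun G => G.toFun) H)
  refine der_ext fun u => ?_
  induction u using FreeLieAlgebra.induction with
  | of i => exact h i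
  | zero => simp
  | add u v hu hv => simp [hu, hv]
  | smul c u hu => simp [hu]
  | lie u v hu hv => rw [← bracket_ι_ι, E.map_bracket, F.map_bracket, hu, hv]

end FreePoisson

end

/-! ### The generators as non-associate primes. -/

/-- Extend the family to a basis: the symmetric algebra becomes a polynomial ring in which the given
vectors are distinct variables. -/
theorem SymmetricAlgebra.prime_ι_and_not_dvd {K M : Type*} [Field K] [AddCommGroup M] [Module K M]
    {ι : Type*} {v : ι → M} (hv : LinearIndependent K v) :
    (∀ i, Prime (SymmetricAlgebra.ι K M (v i))) ∧
      ∀ i j, i ≠ j → ¬ SymmetricAlgebra.ι K M (v i) ∣ SymmetricAlgebra.ι K M (v j) := by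
  let b := Module.Basis.extend hv.linearIndepOn_id
  let e := SymmetricAlgebra.equivMvPolynomial b
  let s : ι → _ := fun i => (⟨v i, hv.linearIndepOn_id.subset_extend _ ⟨i, rfl⟩⟩ :
    hv.linearIndepOn_id.extend (Set.subset_univ _))
  have hs : ∀ i, e (SymmetricAlgebra.ι K M (v i)) = MvPolynomial.X (s i) := fun i => by
    have h : b (s i) = v i := Module.Basis.extend_apply_self _ _
    rw [← h, SymmetricAlgebra.equivMvPolynomial_ι_apply]
  refine ⟨fun i => ?_, fun i j hij h => hij ?_⟩
  · rw [← MulEquiv.prime_iff e, hs]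
    exact MvPolynomial.X_prime
  · have h' := map_dvd e h
    rw [hs, hs, MvPolynomial.X_dvd_X] at h'
    exact hv.injective (congrArg Subtype.val h')

section

attribute [local instance 100] LieRing.ofAssociativeRing

theorem FreeLieAlgebra.linearIndependent_of {R X : Type*} [CommRing R] :
    LinearIndependent R (FreeLieAlgebra.of R : X → FreeLieAlgebra R X) := by
  classical
  -- The target is abelian, and the generators go to the standard unit vectors.
  let φ : FreeLieAlgebra R X →ₗ⁅R⁆ (X → R) := FreeLieAlgebra.lift R fun i => Pi.single i 1
  refine LinearIndependent.of_comp (φ : FreeLieAlgebra R X →ₗ[R] (X → R)) ?_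
  have h : ⇑(φ : FreeLieAlgebra R X →ₗ[R] (X → R)) ∘ of R = fun i => Pi.single i 1 :=
    funext fun i => by simp [φ]
  rw [h]
  exact Pi.linearIndependent_single_one X R

end

namespace FreePoisson

open PoissonEnveloping

section

variable {K : Type*} [Field K] {n : ℕ}

theorem prime_x (i : Fin n) : Prime (x K i) :=
  (SymmetricAlgebra.prime_ι_and_not_dvd FreeLieAlgebra.linearIndependent_of).1 i

theorem not_x_dvd_x {i j : Fin n} (h : i ≠ j) : ¬ x K i ∣ x K j :=
  (SymmetricAlgebra.prime_ι_and_not_dvd FreeLieAlgebra.linearIndependent_of).2 i j h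

end

/-! ### The grading by degree. -/

section

variable {K : Type*} [CommRing K] {n : ℕ}

theorem mem_span_isLieWord (u : FreeLieAlgebra K (Fin n)) :
    u ∈ Submodule.span K {u | ∃ m, IsLieWord K u m} := by
  induction u using FreeLieAlgebra.induction with
  | of i => exact Submodule.subset_span ⟨1, .of i⟩
  | zero => exact zero_mem _
  | add u v hu hv => exact add_mem hu hv
  | smul c u hu => exact Submodule.smul_mem _ c hu
  | lie u v hu hv =>
    induction hu using Submodule.span_induction with
    | zero => simp
    | add u u' _ _ h h' => rw [add_lie]; exact add_mem h h'
    | smul c u _ h => rw [smul_lie]; exact Submodule.smul_mem _ c h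
    | mem u hu =>
      induction hv using Submodule.span_induction with
      | zero => simp
      | add v v' _ _ h h' => rw [lie_add]; exact add_mem h h'
      | smul c v _ h => rw [lie_smul]; exact Submodule.smul_mem _ c h
      | mem v hv =>
        obtain ⟨k, hu⟩ := hu
        obtain ⟨m, hv⟩ := hv
        exact Submodule.subset_span ⟨k + m, hu.lie hv⟩

theorem span_isMonomial_eq_top :
    Submodule.span K {f : FreePoisson K n | ∃ m, IsMonomial K f m} = ⊤ := by
  rw [eq_top_iff]
  rintro f -
  induction f using SymmetricAlgebra.induction with
  | algebraMap r =>
    rw [Algebra.algebraMap_eq_smul_one]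
    exact Submodule.smul_mem _ r (Submodule.subset_span ⟨0, .one⟩)
  | add f g hf hg => exact add_mem hf hg
  | ι u =>
    have h := Submodule.mem_map_of_mem (f := SymmetricAlgebra.ι K _) (mem_span_isLieWord u)
    rw [Submodule.map_span] at h
    refine Submodule.span_mono ?_ h
    rintro _ ⟨u, ⟨m, hu⟩, rfl⟩
    exact ⟨m + 0, by simpa using IsMonomial.lie_mul hu .one⟩
  | mul f g hf hg =>
    have h := Submodule.mul_mem_mul hf hg
    rw [Submodule.span_mul_span] at h
    refine Submodule.span_mono ?_ h
    rintro _ ⟨f, ⟨k, hf⟩, g, ⟨m, hg⟩, rfl⟩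
    exact ⟨k + m, hf.mul hg⟩

theorem x_mem_homogeneous (i : Fin n) : x K i ∈ homogeneous K n 1 := (IsLieWord.of i).ι_mem

theorem homogeneous_le_gradedPart (d m : ℕ) :
    homogeneous K n m ≤ gradedPart K n d (m : ZMod d) :=
  fun _ hf => Submodule.subset_span ⟨m, rfl, hf⟩

variable (K n) in
/-- The Poisson derivation of the free Poisson algebra that fixes the generators. -/
noncomputable def euler : PoissonDerivation K (FreePoisson K n) := derivationOf (x K)

theorem euler_ι_of_isLieWord {u : FreeLieAlgebra K (Fin n)} {m : ℕ} (hu : IsLieWord K u m) :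
    (euler K n).toDerivation (SymmetricAlgebra.ι K _ u) = (m : K) • SymmetricAlgebra.ι K _ u := by
  induction hu with
  | of i => rw [Nat.cast_one, one_smul]; exact derivationOf_x _ i
  | lie _ _ hu hv =>
    rw [← bracket_ι_ι, (euler K n).map_bracket, hu, hv, poissonBracket_smul_left]
    simp [add_smul]

theorem euler_of_mem_homogeneous {f : FreePoisson K n} {m : ℕ} (hf : f ∈ homogeneous K n m) :
    (euler K n).toDerivation f = (m : K) • f := by
  induction hf using Submodule.span_induction with
  | zero => simp
  | add f g _ _ hf hg => simp [hf, hg]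
  | smul c f _ hf => rw [Derivation.map_smul, hf, smul_comm]
  | mem f hf =>
    induction hf with
    | one => simp
    | lie_mul hu _ ih =>
      rw [Derivation.leibniz, ih, euler_ι_of_isLieWord hu]
      simp only [smul_eq_mul, Algebra.smul_def, Nat.cast_add, map_add]
      ring

end

section

variable {K : Type*} [Field K] [CharZero K] {n : ℕ}

variable (K n) in
-- Elements of degree `m` are eigenvectors of the Euler derivation with eigenvalue `m`, and in
-- characteristic zero these eigenvalues are distinct, so the pieces are independent. Monomials
-- span.
theorem isInternal_homogeneous : DirectSum.IsInternal (homogeneous K n) := by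
  refine DirectSum.isInternal_submodule_of_iSupIndep_of_iSup_eq_top ?_ ?_
  · refine iSupIndep.mono ((Module.End.eigenspaces_iSupIndep
      ((euler K n).toDerivation : FreePoisson K n →ₗ[K] FreePoisson K n)).comp
        (f := fun m : ℕ => (m : K)) Nat.cast_injective) fun m f hf => ?_
    exact Module.End.mem_eigenspace_iff.2 (euler_of_mem_homogeneous hf)
  · rw [eq_top_iff, ← span_isMonomial_eq_top, Submodule.span_le]
    rintro f ⟨m, hf⟩
    exact Submodule.mem_iSup_of_mem m (Submodule.subset_span hf)

noncomputable instance : GradedAlgebra (homogeneous K n) where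
  one_mem := Submodule.subset_span IsMonomial.one
  mul_mem := fun _ _ _ _ => mul_mem_homogeneous
  toDecomposition := (isInternal_homogeneous K n).chooseDecomposition

theorem decompose_eq_zero_of_mem_gradedPart {d m : ℕ} {i : ZMod d} (hm : (m : ZMod d) ≠ i)
    {f : FreePoisson K n} (hf : f ∈ gradedPart K n d i) :
    (DirectSum.decompose (homogeneous K n) f m : FreePoisson K n) = 0 := by
  induction hf using Submodule.span_induction with
  | zero => simp
  | add f g _ _ hf hg => simp [hf, hg]
  | smul c f _ hf => rw [DirectSum.decompose_smul, DirectSum.smul_apply, Submodule.coe_smul, hf, smul_zero]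
  | mem f hf =>
    obtain ⟨k, rfl, hf⟩ := hf
    exact DirectSum.decompose_of_mem_ne _ hf fun h => hm (h ▸ rfl)

/-- A quotient of elements of the `d`-graded algebra by a homogeneous element is `d`-graded. -/
theorem mem_gradedPart_of_mul_mem {d k : ℕ} {i : ZMod d} {f g : FreePoisson K n}
    (hf : f ∈ homogeneous K n k) (hf0 : f ≠ 0) (h : f * g ∈ gradedPart K n d (k + i)) :
    g ∈ gradedPart K n d i := by
  classical
  rw [← DirectSum.sum_support_decompose (homogeneous K n) g]
  refine sum_mem fun m _ => ?_
  by_cases hm : (m : ZMod d) = i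
  · exact hm ▸ homogeneous_le_gradedPart d m (DirectSum.decompose (homogeneous K n) g m).2
  -- The component of `f * g` in degree `k + m` is `f` times that of `g` in degree `m`; it vanishes
  -- when `m` is not congruent to `i`, and `f` cancels.
  · have h0 := decompose_eq_zero_of_mem_gradedPart (m := k + m)
      (fun e => hm (add_left_cancel (a := (k : ZMod d)) (by rwa [Nat.cast_add] at e))) h
    rw [DirectSum.coe_decompose_mul_add_of_left_mem _ hf] at h0
    rw [(mul_eq_zero.1 h0).resolve_left hf0]
    exact zero_mem _

end

end FreePoisson

/-! ### Brackets of powers, and the values of `D` on `xᵢ ^ d`. -/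

namespace PoissonEnveloping

variable {K L : Type*} [CommRing K] [LieRing L] [LieAlgebra K L]

theorem ham_pow_succ_apply (a b : SymmetricAlgebra K L) (k : ℕ) :
    ham K L (a ^ (k + 1)) b = (k + 1 : ℕ) * a ^ k * ham K L a b := by
  rw [ham_antisymm, Derivation.leibniz_pow, ham_antisymm K L b a, smul_neg, smul_neg, neg_neg,
    nsmul_eq_mul, smul_eq_mul, mul_assoc, Nat.add_sub_cancel]

/-- The Leibniz rule in both arguments, with `{a, a} = 0`. It is used to recover a multiple of `{f,
g}` by a power of `a` from brackets of such multiples of `f` and `g`, up to corrections involving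
only `{f, a}` and `{g, a}`. -/
theorem ham_pow_mul_pow_mul (a f g : SymmetricAlgebra K L) (r s : ℕ) :
    ham K L (a ^ (r + 1) * f) (a ^ (s + 1) * g) =
      a ^ (r + s + 2) * ham K L f g + (s + 1 : ℕ) * a ^ (r + s + 1) * g * ham K L f a -
        (r + 1 : ℕ) * a ^ (r + s + 1) * f * ham K L g a := by
  simp only [ham_mul, Derivation.add_apply, Derivation.smul_apply, Derivation.leibniz,
    Derivation.leibniz_pow, ham_pow_succ_apply, ham_self, ham_antisymm K L g a, smul_eq_mul,
    nsmul_eq_mul, Nat.add_sub_cancel]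
  ring

end PoissonEnveloping

namespace FreePoisson

theorem mem_veronese_iff {K : Type*} [CommRing K] {n d : ℕ} {f : FreePoisson K n} :
    f ∈ veronese K n d ↔ f ∈ gradedPart K n d 0 := Iff.rfl

theorem mem_veronese_of_homogeneous {K : Type*} [CommRing K] {n d m : ℕ} {f : FreePoisson K n}
    (hf : f ∈ homogeneous K n m) (hm : d ∣ m) : f ∈ veronese K n d := by
  rw [mem_veronese_iff, ← (ZMod.natCast_eq_zero_iff m d).2 hm]
  exact homogeneous_le_gradedPart d m hf

theorem x_pow_mem_homogeneous {K : Type*} [CommRing K] {n : ℕ} (i : Fin n) (k : ℕ) :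
    x K i ^ k ∈ homogeneous K n k := by
  induction k with
  | zero => rw [pow_zero]; exact Submodule.subset_span IsMonomial.one
  | succ k ih => rw [pow_succ]; exact mul_mem_homogeneous ih (x_mem_homogeneous i)

theorem x_pow_mem_veronese {K : Type*} [CommRing K] {n : ℕ} (d : ℕ) (i : Fin n) :
    x K i ^ d ∈ veronese K n d :=
  mem_veronese_of_homogeneous (x_pow_mem_homogeneous i d) dvd_rfl

theorem x_pow_mul_x_mem_veronese {K : Type*} [CommRing K] {n e : ℕ} (i j : Fin n) :
    x K i ^ (e + 1) * x K j ∈ veronese K n (e + 2) :=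
  mem_veronese_of_homogeneous
    (mul_mem_homogeneous (x_pow_mem_homogeneous i _) (x_mem_homogeneous j)) dvd_rfl

section

variable {K : Type*} [Field K] {n d : ℕ}

/-- In the Veronese subalgebra, `D (xᵢ ^ d)` is divisible by `xᵢ ^ (d - 1)`. -/
theorem x_pow_dvd_derivation (hn : 2 ≤ n) (hd : 2 ≤ d)
    (D : PoissonDerivation K (veronese K n d)) (i : Fin n) :
    x K i ^ (d - 1) ∣ (D.toDerivation ⟨x K i ^ d, x_pow_mem_veronese d i⟩ : FreePoisson K n) := by
  obtain ⟨e, rfl⟩ := Nat.exists_eq_add_of_le' hd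
  have : Nontrivial (Fin n) := Fin.nontrivial_iff_two_le.2 hn
  obtain ⟨j, hj⟩ := exists_ne i
  set X : veronese K n (e + 2) := ⟨x K i ^ (e + 2), x_pow_mem_veronese _ i⟩ with hX
  set Y : veronese K n (e + 2) := ⟨x K j ^ (e + 2), x_pow_mem_veronese _ j⟩ with hY
  set M : veronese K n (e + 2) := ⟨x K j ^ (e + 1) * x K i, x_pow_mul_x_mem_veronese j i⟩ with hM
  have h : M ^ (e + 2) = X * Y ^ (e + 1) := by
    apply Subtype.ext
    simp only [hX, hY, hM, SubmonoidClass.coe_pow, MulMemClass.coe_mul]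
    ring
  have hc (k : ℕ) : ((k : veronese K n (e + 2)) : FreePoisson K n) = k := rfl
  have hD := congrArg (fun f => (D.toDerivation f : FreePoisson K n)) h
  simp only [Derivation.leibniz, Derivation.leibniz_pow, smul_eq_mul, nsmul_eq_mul,
    MulMemClass.coe_mul, SubmonoidClass.coe_pow, AddMemClass.coe_add, Nat.add_sub_cancel,
    show e + 2 - 1 = e + 1 from rfl, hc] at hD
  rw [show (M : FreePoisson K n) = x K j ^ (e + 1) * x K i from rfl,
    show (X : FreePoisson K n) = x K i ^ (e + 2) from rfl,
    show (Y : FreePoisson K n) = x K j ^ (e + 2) from rfl] at hD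
  -- With `d = e + 2`, every term of `hD` contains `xⱼ ^ (d (d - 2))`. Cancelling it leaves `xⱼ ^ d
  -- D X = xᵢ ^ (d - 1) (d xⱼ D M - (d - 1) xᵢ D Y)`.
  have hy : x K j ^ (e * (e + 2)) ≠ 0 := pow_ne_zero _ (prime_x j).ne_zero
  change x K i ^ (e + 1) ∣ _
  refine (prime_x i).pow_dvd_of_dvd_mul_left _ (fun h' => not_x_dvd_x hj.symm
    ((prime_x i).dvd_of_dvd_pow h')) (a := x K j ^ (e + 2))
    ⟨((e + 2 : ℕ) : FreePoisson K n) * x K j * D.toDerivation M -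
      ((e + 1 : ℕ) : FreePoisson K n) * x K i * D.toDerivation Y, mul_left_cancel₀ hy ?_⟩
  linear_combination -hD

variable [CharZero K]

theorem charZero_freePoisson : CharZero (FreePoisson K n) := algebraRat.charZero _

theorem exists_derivation_values (hn : 2 ≤ n) (hd : 2 ≤ d)
    (D : PoissonDerivation K (veronese K n d)) (i : Fin n) : ∃ a : FreePoisson K n,
      (D.toDerivation ⟨x K i ^ d, x_pow_mem_veronese d i⟩ : FreePoisson K n) =
        d • x K i ^ (d - 1) • a := by
  obtain ⟨b, hb⟩ := x_pow_dvd_derivation hn hd D i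
  refine ⟨(d : K)⁻¹ • b, ?_⟩
  have hd0 : (d : K) ≠ 0 := Nat.cast_ne_zero.2 (by omega)
  rw [hb, smul_eq_mul, mul_smul_comm, ← Nat.cast_smul_eq_nsmul K, smul_inv_smul₀ hd0]

end

/-! ### The set on which two derivations agree. -/

section

variable {K : Type*} [Field K] {n d : ℕ}

/-- `f` lies in the Veronese subalgebra, and `E` and `D` agree on it. -/
def Agree (E : PoissonDerivation K (FreePoisson K n)) (D : PoissonDerivation K (veronese K n d))
    (f : FreePoisson K n) : Prop :=
  ∃ h : f ∈ veronese K n d, E.toDerivation f = (D.toDerivation ⟨f, h⟩ : FreePoisson K n)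

namespace Agree

variable {E : PoissonDerivation K (FreePoisson K n)} {D : PoissonDerivation K (veronese K n d)}
  {f g : FreePoisson K n}

theorem add (hf : Agree E D f) (hg : Agree E D g) : Agree E D (f + g) := by
  obtain ⟨hf, hf'⟩ := hf
  obtain ⟨hg, hg'⟩ := hg
  refine ⟨add_mem hf hg, ?_⟩
  rw [map_add, hf', hg', ← AddMemClass.coe_add, ← map_add]
  rfl

theorem smul (c : K) (hf : Agree E D f) : Agree E D (c • f) := by
  obtain ⟨hf, hf'⟩ := hf
  refine ⟨Subalgebra.smul_mem _ hf c, ?_⟩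
  rw [Derivation.map_smul, hf', ← Subalgebra.coe_smul, ← Derivation.map_smul]
  rfl

theorem sub (hf : Agree E D f) (hg : Agree E D g) : Agree E D (f - g) := by
  rw [sub_eq_add_neg, ← neg_one_smul K g]
  exact hf.add (hg.smul _)

theorem zero : Agree E D 0 :=
  ⟨zero_mem _, by rw [map_zero]; exact congrArg Subtype.val (map_zero D.toDerivation).symm⟩

theorem one : Agree E D 1 :=
  ⟨one_mem _, by
    rw [Derivation.map_one_eq_zero]
    exact congrArg Subtype.val D.toDerivation.map_one_eq_zero.symm⟩

theorem mul (hf : Agree E D f) (hg : Agree E D g) : Agree E D (f * g) := by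
  obtain ⟨hf, hf'⟩ := hf
  obtain ⟨hg, hg'⟩ := hg
  refine ⟨mul_mem hf hg, ?_⟩
  rw [Derivation.leibniz, hf', hg']
  exact congrArg Subtype.val (D.toDerivation.leibniz ⟨f, hf⟩ ⟨g, hg⟩).symm

theorem pow (hf : Agree E D f) (k : ℕ) : Agree E D (f ^ k) := by
  induction k with
  | zero => rw [pow_zero]; exact one
  | succ k ih => rw [pow_succ]; exact ih.mul hf

theorem bracket (hf : Agree E D f) (hg : Agree E D g) : Agree E D (poissonBracket K f g) := by
  obtain ⟨hf, hf'⟩ := hf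
  obtain ⟨hg, hg'⟩ := hg
  refine ⟨bracket_mem_veronese hf hg, ?_⟩
  rw [E.map_bracket, hf', hg']
  exact congrArg Subtype.val (D.map_bracket ⟨f, hf⟩ ⟨g, hg⟩).symm

/-- The Leibniz rule for `f * g` determines `f` times the derivative of `g`, and `P` is a domain. -/
theorem of_mul_left (hf0 : f ≠ 0) (hg : g ∈ veronese K n d) (hf : Agree E D f)
    (h : Agree E D (f * g)) : Agree E D g := by
  obtain ⟨hf, hf'⟩ := hf
  obtain ⟨_, h⟩ := h
  refine ⟨hg, mul_left_cancel₀ hf0 ?_⟩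
  have hD := congrArg Subtype.val (D.toDerivation.leibniz ⟨f, hf⟩ ⟨g, hg⟩)
  have h' := h.trans hD
  rw [Derivation.leibniz, hf'] at h'
  exact add_right_cancel h'

variable [CharZero K]

/-- Both derivatives of `f ^ k` are `k f ^ (k - 1)` times the derivative of `f`, and this factor
cancels in a domain of characteristic zero. -/
theorem of_pow (hf : f ∈ veronese K n d) {k : ℕ} (hk : k ≠ 0) (h : Agree E D (f ^ k)) :
    Agree E D f := by
  by_cases hf0 : f = 0
  · rw [hf0]; exact zero
  obtain ⟨_, h⟩ := h
  have hD := congrArg Subtype.val (D.toDerivation.leibniz_pow ⟨f, hf⟩ k)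
  have h' := h.trans hD
  have := charZero_freePoisson (K := K) (n := n)
  rw [Derivation.leibniz_pow] at h'
  refine ⟨hf, mul_left_cancel₀ (pow_ne_zero (k - 1) hf0) ?_⟩
  exact smul_right_injective _ hk h'

/-- If two derivations agree on the `d`-th powers of the generators, then they agree on every
Lie word up to multiplication by a power of `xᵢ`. -/
theorem exists_x_pow_mul_isLieWord (hd : 2 ≤ d) (hx : ∀ j, Agree E D (x K j ^ d)) (i : Fin n)
    {u : FreeLieAlgebra K (Fin n)} {m : ℕ} (hu : IsLieWord K u m) :
    ∃ r, Agree E D (x K i ^ (r + 1) * SymmetricAlgebra.ι K _ u) := by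
  obtain ⟨e, rfl⟩ := Nat.exists_eq_add_of_le' hd
  -- Since `{xᵢ ^ (r + 1) f, xᵢ ^ d} = d xᵢ ^ (r + d) {f, xᵢ}`, bracketing with `xᵢ ^ d` supplies
  -- the correction terms needed below.
  have hxu {r : ℕ} {f : FreePoisson K n} (hf : Agree E D (x K i ^ (r + 1) * f)) :
      Agree E D (x K i ^ (r + (e + 2)) * poissonBracket K f (x K i)) := by
    have h := (hf.bracket (hx i)).smul ((e + 2 : ℕ) : K)⁻¹
    convert h using 1
    rw [PoissonEnveloping.poissonBracket_eq_ham, PoissonEnveloping.poissonBracket_eq_ham,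
      Derivation.leibniz_pow, PoissonEnveloping.ham_mul, Derivation.add_apply,
      Derivation.smul_apply, Derivation.smul_apply, PoissonEnveloping.ham_pow_succ_apply,
      PoissonEnveloping.ham_self, ← Nat.cast_smul_eq_nsmul K,
      inv_smul_smul₀ (Nat.cast_ne_zero.2 (by omega))]
    simp only [smul_eq_mul, mul_zero, add_zero, show e + 2 - 1 = e + 1 from rfl]
    ring
  induction hu with
  | of j =>
    -- The `d`-th power of `xᵢ ^ (d - 1) xⱼ` is a product of `d`-th powers of generators.
    refine ⟨e, of_pow (x_pow_mul_x_mem_veronese i j) (k := e + 2) (by omega) ?_⟩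
    have h := ((hx i).pow (e + 1)).mul (hx j)
    convert h using 1
    change (x K i ^ (e + 1) * x K j) ^ (e + 2) = _
    ring
  | @lie u v _ _ _ _ hu hv =>
    obtain ⟨r, hu⟩ := hu
    obtain ⟨s, hv⟩ := hv
    refine ⟨r + s + 1 + (e + 2), ?_⟩
    -- Multiplying the bracket by `xᵢ ^ d` brings its unwanted terms to the exponent `r + s + 1 + d`
    -- produced by `hxu`, so they can be subtracted.
    have h := ((hx i).mul (hu.bracket hv)).sub
      (((hv.mul (hxu hu)).smul ((s + 1 : ℕ) : K)).sub ((hu.mul (hxu hv)).smul ((r + 1 : ℕ) : K)))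
    convert h using 1
    rw [← PoissonEnveloping.bracket_ι_ι, PoissonEnveloping.poissonBracket_eq_ham,
      PoissonEnveloping.poissonBracket_eq_ham, PoissonEnveloping.poissonBracket_eq_ham,
      PoissonEnveloping.poissonBracket_eq_ham, PoissonEnveloping.ham_pow_mul_pow_mul,
      Nat.cast_smul_eq_nsmul, Nat.cast_smul_eq_nsmul, nsmul_eq_mul, nsmul_eq_mul]
    ring

theorem exists_x_pow_mul_isMonomial (hd : 2 ≤ d) (hx : ∀ j, Agree E D (x K j ^ d)) (i : Fin n)
    {m : ℕ} (hf : IsMonomial K f m) : ∃ r, Agree E D (x K i ^ r * f) := by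
  induction hf with
  | one => exact ⟨0, by simpa using one⟩
  | lie_mul hu _ ih =>
    obtain ⟨r, hr⟩ := exists_x_pow_mul_isLieWord hd hx i hu
    obtain ⟨s, hs⟩ := ih
    refine ⟨r + 1 + s, ?_⟩
    rw [pow_add, mul_mul_mul_comm]
    exact hr.mul hs

theorem of_isMonomial (hd : 2 ≤ d) (hx : ∀ j, Agree E D (x K j ^ d)) (i : Fin n)
    {m : ℕ} (hm : (m : ZMod d) = 0) (hf : IsMonomial K f m) : Agree E D f := by
  by_cases hf0 : f = 0
  · rw [hf0]; exact zero
  have hfm : f ∈ homogeneous K n m := Submodule.subset_span hf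
  obtain ⟨r, h⟩ := exists_x_pow_mul_isMonomial hd hx i hf
  -- Both `f` and `xᵢ ^ r * f` have degree `0` modulo `d`, hence so does the quotient `xᵢ ^ r`. Its
  -- `d`-th power is `(xᵢ ^ d) ^ r`, which gives agreement on it.
  have hr : x K i ^ r ∈ veronese K n d := by
    refine mem_gradedPart_of_mul_mem hfm hf0 ?_
    rw [hm, add_zero, mul_comm]
    exact h.1
  have hxr : Agree E D (x K i ^ r) := by
    refine of_pow hr (k := d) (by omega) ?_
    rw [pow_right_comm]
    exact (hx i).pow r
  exact of_mul_left (pow_ne_zero r (prime_x i).ne_zero)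
    (mem_veronese_of_homogeneous hfm ((ZMod.natCast_eq_zero_iff m d).1 hm)) hxr h

theorem of_mem_veronese (hd : 2 ≤ d) (hx : ∀ j, Agree E D (x K j ^ d)) (i : Fin n)
    (hf : f ∈ veronese K n d) : Agree E D f := by
  rw [mem_veronese_iff] at hf
  induction hf using Submodule.span_induction with
  | zero => exact zero
  | add f g _ _ hf hg => exact hf.add hg
  | smul c f _ hf => exact hf.smul c
  | mem f hf =>
    obtain ⟨m, hm, hf⟩ := hf
    induction hf using Submodule.span_induction with
    | zero => exact zero
    | add f g _ _ hf hg => exact hf.add hg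
    | smul c f _ hf => exact hf.smul c
    | mem f hf => exact of_isMonomial hd hx i hm hf

end Agree

end

end FreePoisson

/-! ### Existence and uniqueness of the extension. -/

theorem lemma2 {K : Type*} [Field K] [CharZero K] (n d : ℕ) (hn : 2 ≤ n) (hd : 2 ≤ d)
    (D : PoissonDerivation K (FreePoisson.veronese K n d)) :
    ∃! E : PoissonDerivation K (FreePoisson K n),
      FreePoisson.IsGradedDerivation d E ∧
        ∀ f : FreePoisson.veronese K n d,
          E.toDerivation (f : FreePoisson K n) = (D.toDerivation f : FreePoisson K n) := by
  choose a ha using FreePoisson.exists_derivation_values hn hd D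
  have := FreePoisson.charZero_freePoisson (K := K) (n := n)
  have hd0 : d ≠ 0 := by omega
  have hx0 (i : Fin n) : FreePoisson.x K i ^ (d - 1) ≠ 0 :=
    pow_ne_zero _ (FreePoisson.prime_x i).ne_zero
  have hE : ∀ i, FreePoisson.Agree (FreePoisson.derivationOf a) D (FreePoisson.x K i ^ d) :=
    fun i => ⟨FreePoisson.x_pow_mem_veronese d i, by
      rw [ha, Derivation.leibniz_pow, FreePoisson.derivationOf_x]⟩
  refine ⟨FreePoisson.derivationOf a, ⟨fun i => ?_, fun f => ?_⟩, ?_⟩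
  · rw [FreePoisson.derivationOf_x]
    -- Since `(d - 1) + 1` is `0` modulo `d`, it suffices that `xᵢ ^ (d - 1) aᵢ` lies in `P_0`; it
    -- is `D (xᵢ ^ d)` divided by the scalar `d`.
    refine FreePoisson.mem_gradedPart_of_mul_mem
      (FreePoisson.x_pow_mem_homogeneous i (d - 1)) (hx0 i) ?_
    have h := Submodule.smul_mem _ ((d : K)⁻¹)
      (D.toDerivation ⟨_, FreePoisson.x_pow_mem_veronese d i⟩).2
    rw [ha, ← Nat.cast_smul_eq_nsmul K, inv_smul_smul₀ (Nat.cast_ne_zero.2 hd0)] at h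
    convert h using 1
    have e : ((d - 1 : ℕ) : ZMod d) + 1 = ((d - 1 + 1 : ℕ) : ZMod d) := by push_cast; rfl
    rw [e, Nat.sub_add_cancel (by omega), ZMod.natCast_self]
    rfl
  · exact (FreePoisson.Agree.of_mem_veronese hd hE ⟨0, by omega⟩ f.2).2
  · rintro F ⟨-, hF⟩
    refine FreePoisson.poissonDerivation_ext fun i => ?_
    rw [FreePoisson.derivationOf_x]
    -- Both values, multiplied by `d xᵢ ^ (d - 1)`, give `D (xᵢ ^ d)`.
    refine mul_left_cancel₀ (hx0 i) (smul_right_injective _ hd0 ?_)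
    have h := hF ⟨_, FreePoisson.x_pow_mem_veronese d i⟩
    rw [ha, Derivation.leibniz_pow] at h
    exact h
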